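/- A (partial) multivalued function on Cantor space $2^{\mathbb N}=\{0,1\}^{\mathbb N}$ assigns to every $x\in 2^{\mathbb N}$ a set $f(x)\subseteq 2^{\mathbb N}$; $\operatorname{dom}(f)=\{x: f(x)\neq\emptyset\}$. Write $f\le_{\mathrm W} g$ (Weihrauch reducibility) if there are computable partial functions $H:\subseteq 2^{\mathbb N}\to 2^{\mathbb N}$ and $K:\subseteq 2^{\mathbb N}\times 2^{\mathbb N}\to 2^{\mathbb N}$ such that for all $x\in\operatorname{dom}(f)$, $H(x)$ is defined and lies in $\operatorname{dom}(g)$, and for all $y\in g(H(x))$, $K(x,y)$ is defined and $K(x,y)\in f(x)$. If $K$ does not depend on its first argument, write $f\le_{\mathrm{sW}} g$ (strong Weihrauch reducibility). Let $\mathfrak W$ and $\mathfrak W^s$ be the sets of equivalence classes of multivalued functions on $2^{\mathbb N}$ under the equivalence relations induced by $\le_{\mathrm W}$ and $\le_{\mathrm{sW}}$. With $\langle\cdot,\cdot\rangle$ a standard pairing function on $2^{\mathbb N}$, both carry the operations induced by the following ones on multivalued functions: $f\sqcap g$ has domain $\{\langle q_0,q_1\rangle : q_0\in\operatorname{dom}(f),\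 q_1\in\operatorname{dom}(g)\}$ and $(f\sqcap g)(\langle q_0,q_1\rangle)=\{0p: p\in f(q_0)\}\cup\{1p: p\in g(q_1)\}$ on it; and $(f\times g)(\langle q_0,q_1\rangle)=\{\langle p_0,p_1\rangle : p_0\in f(q_0),\ p_1\in g(q_1)\}$. Corollary 15. $(\mathfrak W,\sqcap,\times)$ and $(\mathfrak W^s,\sqcap,\times)$ have the same equational theory: for all terms $t,u$ built from countably many variables with the binary operations $\sqcap$ and $\times$, the equation $t=u$ holds in $\mathfrak W$ under every assignment of Weihrauch degrees to the variables if and only if it holds in $\mathfrak W^s$ under every assignment of strong Weihrauch degrees to the variables. -/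

import Mathlib

namespace Weihrauch

/-! ### Computable partial functions on Cantor space -/

/-- Cantor space, the set of infinite binary sequences. -/
abbrev Cantor : Type := ℕ → Bool

/-- The finite word consisting of the first `n` bits of `x`. -/
def pre (x : Cantor) (n : ℕ) : List Bool := (List.range n).map x

/-- A partial function `F` on Cantor space is computable if there is a computable function `h` on
finite binary words, monotone for the prefix order, such that for every `x` in the domain of `F`
the infinite sequence `F x` is the supremum of the words `h (pre x n)`, `n ∈ ℕ`. -/
def IsComputable (F : Cantor →. Cantor) : Prop :=
  ∃ h : List Bool → List Bool, Computable h ∧ (∀ u v, u <+: v → h u <+: h v) ∧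
    ∀ x, ∀ y ∈ F x, ∀ m, ∃ n, pre y m <+: h (pre x n)

/-- The standard pairing function on Cantor space: `p` on the even and `q` on the odd positions. -/
def pair (p q : Cantor) : Cantor := fun n => if n % 2 = 0 then p (n / 2) else q (n / 2)

/-- First component of the inverse of the pairing function. -/
def fst (p : Cantor) : Cantor := fun n => p (2 * n)

/-- Second component of the inverse of the pairing function. -/
def snd (p : Cantor) : Cantor := fun n => p (2 * n + 1)

/-- The sequence `bp` that starts with the bit `b` and continues with `p`. -/
def cons (b : Bool) (p : Cantor) : Cantor
  | 0 => b
  | n + 1 => p n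

/-- The sequence `p` with its first bit removed. -/
def tail (p : Cantor) : Cantor := fun n => p (n + 1)

/-- Computability of a partial function of two arguments, by means of the pairing function. -/
def IsComputable₂ (K : Cantor → Cantor →. Cantor) : Prop :=
  IsComputable fun p => K (fst p) (snd p)

/-! ### Multivalued functions and (strong) Weihrauch reducibility -/

/-- Partial multivalued functions on Cantor space: `f x` is the set of the values of `f` at `x`. -/
abbrev MultiFun : Type := Cantor → Set Cantor

/-- The domain of a multivalued function. -/
def dom (f : MultiFun) : Set Cantor := {x | (f x).Nonempty}

/-- Weihrauch reducibility. -/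
def WLE (f g : MultiFun) : Prop :=
  ∃ (H : Cantor →. Cantor) (K : Cantor → Cantor →. Cantor), IsComputable H ∧ IsComputable₂ K ∧
    ∀ x ∈ dom f, ∃ z ∈ H x, z ∈ dom g ∧ ∀ y ∈ g z, ∃ w ∈ K x y, w ∈ f x

/-- Strong Weihrauch reducibility: the outer reduction witness has no access to `x`. -/
def SWLE (f g : MultiFun) : Prop :=
  ∃ (H : Cantor →. Cantor) (K : Cantor →. Cantor), IsComputable H ∧ IsComputable K ∧
    ∀ x ∈ dom f, ∃ z ∈ H x, z ∈ dom g ∧ ∀ y ∈ g z, ∃ w ∈ K y, w ∈ f x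

/-- The operation `⊓`: an instance is a pair of an instance of `f` and an instance of `g`, a
solution is a solution of one of the two, with a first bit that tells of which one. -/
def meet (f g : MultiFun) : MultiFun := fun q =>
  {r | fst q ∈ dom f ∧ snd q ∈ dom g ∧
    ((∃ p ∈ f (fst q), r = cons false p) ∨ (∃ p ∈ g (snd q), r = cons true p))}

/-- The operation `×`: solve an instance of `f` and an instance of `g` in parallel. -/
def prod (f g : MultiFun) : MultiFun := fun q =>
  {r | ∃ p₀ ∈ f (fst q), ∃ p₁ ∈ g (snd q), r = pair p₀ p₁}

/-! ### Closure properties that are needed to form the degrees -/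

@[simp] theorem fst_pair (p q : Cantor) : fst (pair p q) = p := by
  funext n
  simp [fst, pair]

@[simp] theorem snd_pair (p q : Cantor) : snd (pair p q) = q := by
  funext n
  have h : (2 * n + 1) / 2 = n := by omega
  simp [snd, pair, h]

@[simp] theorem pair_fst_snd (p : Cantor) : pair (fst p) (snd p) = p := by
  funext n
  unfold pair fst snd
  split_ifs with h <;> congr 1 <;> omega

@[simp] theorem tail_cons (b : Bool) (p : Cantor) : tail (cons b p) = p := rfl

@[simp] theorem cons_zero (b : Bool) (p : Cantor) : cons b p 0 = b := rfl

@[simp] theorem length_pre (x : Cantor) (n : ℕ) : (pre x n).length = n := by simp [pre]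

theorem getElem?_pre (x : Cantor) {n i : ℕ} (h : i < n) : (pre x n)[i]? = some (x i) := by
  simp [pre, h]

theorem pre_prefix_iff (x : Cantor) (n : ℕ) (u : List Bool) :
    pre x n <+: u ↔ ∀ i < n, u[i]? = some (x i) := by
  rw [List.prefix_iff_getElem?]
  simp [pre]

theorem pre_mono (x : Cantor) {m n : ℕ} (h : m ≤ n) : pre x m <+: pre x n :=
  (pre_prefix_iff _ _ _).2 fun _ hi => getElem?_pre x (hi.trans_le h)

theorem map_range_prefix {f g : ℕ → Bool} {m n : ℕ} (hmn : m ≤ n) (h : ∀ i < m, f i = g i) :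
    (List.range m).map f <+: (List.range n).map g := by
  rw [List.prefix_iff_getElem?]
  intro i hi
  have hi' : i < m := by simpa using hi
  simp [hi'.trans_le hmn, h i hi']

theorem getD_eq_of_prefix {u v : List Bool} (h : u <+: v) {i : ℕ} (hi : i < u.length) :
    u.getD i false = v.getD i false := by
  have := List.prefix_iff_getElem?.1 h i hi
  simp [List.getD_eq_getElem?_getD, this, hi]

theorem IsComputable.id : IsComputable fun x => Part.some x :=
  ⟨fun u => u, Computable.id, fun _ _ h => h, fun x y hy m => by
    rw [Part.mem_some_iff] at hy
    subst hy
    exact ⟨m, List.prefix_refl _⟩⟩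

theorem IsComputable.comp {F G : Cantor →. Cantor} (hF : IsComputable F) (hG : IsComputable G) :
    IsComputable fun x => (G x).bind F := by
  obtain ⟨f, hf, mf, hf'⟩ := hF
  obtain ⟨g, hg, mg, hg'⟩ := hG
  refine ⟨fun u => f (g u), hf.comp hg, fun u v h => mf _ _ (mg _ _ h), fun x y hy m => ?_⟩
  obtain ⟨z, hz, hy⟩ := Part.mem_bind_iff.1 hy
  obtain ⟨k, hk⟩ := hf' z y hy m
  obtain ⟨n, hn⟩ := hg' x z hz k
  exact ⟨n, hk.trans (mf _ _ hn)⟩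

theorem IsComputable.fst : IsComputable fun x => Part.some (fst x) := by
  refine ⟨fun u => (List.range ((u.length + 1) / 2)).map fun n => u.getD (2 * n) false, ?_, ?_, ?_⟩
  · refine Primrec.to_comp (Primrec.list_map (Primrec.list_range.comp
      (Primrec.nat_div.comp (Primrec.succ.comp Primrec.list_length) (Primrec.const 2))) ?_)
    exact (Primrec.list_getD false).comp Primrec.fst
      (Primrec.nat_mul.comp (Primrec.const 2) Primrec.snd)
  · intro u v h
    have := h.length_le
    exact map_range_prefix (by omega) fun i hi => getD_eq_of_prefix h (by omega)
  · intro x y hy m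
    rw [Part.mem_some_iff] at hy
    subst hy
    refine ⟨2 * m, map_range_prefix (by simp; omega) fun i hi => ?_⟩
    rw [List.getD_eq_getElem?_getD, getElem?_pre x (by omega)]
    rfl

theorem IsComputable.snd : IsComputable fun x => Part.some (snd x) := by
  refine ⟨fun u => (List.range (u.length / 2)).map fun n => u.getD (2 * n + 1) false, ?_, ?_, ?_⟩
  · refine Primrec.to_comp (Primrec.list_map (Primrec.list_range.comp
      (Primrec.nat_div.comp Primrec.list_length (Primrec.const 2))) ?_)
    exact (Primrec.list_getD false).comp Primrec.fst
      (Primrec.succ.comp (Primrec.nat_mul.comp (Primrec.const 2) Primrec.snd))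
  · intro u v h
    have := h.length_le
    exact map_range_prefix (by omega) fun i hi => getD_eq_of_prefix h (by omega)
  · intro x y hy m
    rw [Part.mem_some_iff] at hy
    subst hy
    refine ⟨2 * m, map_range_prefix (by simp) fun i hi => ?_⟩
    rw [List.getD_eq_getElem?_getD, getElem?_pre x (by omega)]
    rfl

theorem IsComputable.pair {F G : Cantor →. Cantor} (hF : IsComputable F) (hG : IsComputable G) :
    IsComputable fun x => (F x).bind fun a => (G x).map fun b => pair a b := by
  obtain ⟨f, hf, mf, hf'⟩ := hF
  obtain ⟨g, hg, mg, hg'⟩ := hG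
  let I : List Bool × List Bool → List Bool := fun q =>
    (List.range (2 * min q.1.length q.2.length)).map fun n =>
      if n % 2 = 0 then q.1.getD (n / 2) false else q.2.getD (n / 2) false
  have hI : Computable I := by
    refine Primrec.to_comp (Primrec.list_map (Primrec.list_range.comp (Primrec.nat_mul.comp
      (Primrec.const 2) (Primrec.nat_min.comp (Primrec.list_length.comp Primrec.fst)
        (Primrec.list_length.comp Primrec.snd)))) ?_)
    refine Primrec.ite (Primrec.eq.comp (Primrec.nat_mod.comp Primrec.snd (Primrec.const 2))
      (Primrec.const 0)) ?_ ?_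
    · exact (Primrec.list_getD false).comp (Primrec.fst.comp Primrec.fst)
        (Primrec.nat_div.comp Primrec.snd (Primrec.const 2))
    · exact (Primrec.list_getD false).comp (Primrec.snd.comp Primrec.fst)
        (Primrec.nat_div.comp Primrec.snd (Primrec.const 2))
  refine ⟨fun u => I (f u, g u), hI.comp (hf.pair hg), fun u v h => ?_, fun x y hy m => ?_⟩
  · have h1 := mf _ _ h
    have h2 := mg _ _ h
    have l1 := h1.length_le
    have l2 := h2.length_le
    refine map_range_prefix (by simp only; omega) fun i hi => ?_
    simp only at hi ⊢
    rw [getD_eq_of_prefix h1 (by omega), getD_eq_of_prefix h2 (by omega)]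
  · obtain ⟨a, ha, hy⟩ := Part.mem_bind_iff.1 hy
    obtain ⟨b, hb, rfl⟩ := (Part.mem_map_iff _).1 hy
    obtain ⟨k, hk⟩ := hf' x a ha m
    obtain ⟨l, hl⟩ := hg' x b hb m
    refine ⟨max k l, ?_⟩
    have h1 := hk.trans (mf _ _ (pre_mono x (le_max_left k l)))
    have h2 := hl.trans (mg _ _ (pre_mono x (le_max_right k l)))
    have l1 := h1.length_le
    have l2 := h2.length_le
    rw [length_pre] at l1 l2
    refine map_range_prefix (by simp only; omega) fun i hi => ?_
    simp only [Weihrauch.pair, List.getD_eq_getElem?_getD]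
    rw [(pre_prefix_iff _ _ _).1 h1 (i / 2) (by omega),
      (pre_prefix_iff _ _ _).1 h2 (i / 2) (by omega)]
    rfl

theorem IsComputable.cons (b : Bool) : IsComputable fun x => Part.some (cons b x) := by
  refine ⟨fun u => b :: u, Computable.list_cons.comp (Computable.const b) Computable.id,
    fun u v h => by simpa using h, fun x y hy m => ⟨m, ?_⟩⟩
  rw [Part.mem_some_iff] at hy
  subst hy
  rw [pre_prefix_iff]
  rintro (_ | i) hi
  · rfl
  · simpa [Weihrauch.cons] using getElem?_pre x (show i < m by omega)

theorem IsComputable.tail : IsComputable fun x => Part.some (tail x) := by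
  refine ⟨List.tail, Primrec.list_tail.to_comp, fun u v h => by simpa using h.drop 1, fun x y hy m => ⟨m + 1, ?_⟩⟩
  rw [Part.mem_some_iff] at hy
  subst hy
  rw [pre_prefix_iff]
  intro i hi
  simpa [Weihrauch.tail] using getElem?_pre x (show i + 1 < m + 1 by omega)

theorem IsComputable.branch (i : ℕ) {F G : Cantor →. Cantor} (hF : IsComputable F)
    (hG : IsComputable G) : IsComputable fun x => bif x i then G x else F x := by
  obtain ⟨f, hf, mf, hf'⟩ := hF
  obtain ⟨g, hg, mg, hg'⟩ := hG
  refine ⟨fun u => Option.casesOn (u[i]?) [] fun b => bif b then g u else f u, ?_, ?_, ?_⟩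
  · refine Computable.option_casesOn
      (Computable.list_getElem?.comp Computable.id (Computable.const i)) (Computable.const []) ?_
    exact Computable.cond Computable.snd (hg.comp Computable.fst) (hf.comp Computable.fst)
  · intro u v h
    by_cases hi : i < u.length
    · have e := List.prefix_iff_getElem?.1 h i hi
      simp only [e, List.getElem?_eq_getElem hi]
      cases u[i]
      · exact mf _ _ h
      · exact mg _ _ h
    · simp [List.getElem?_eq_none (not_lt.1 hi)]
  · intro x y hy m
    cases hb : x i
    · obtain ⟨n, hn⟩ := hf' x y (by simpa [hb] using hy) m
      refine ⟨max n (i + 1), ?_⟩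
      beta_reduce
      rw [getElem?_pre x (show i < max n (i + 1) by omega), hb]
      exact hn.trans (mf _ _ (pre_mono x (le_max_left _ _)))
    · obtain ⟨n, hn⟩ := hg' x y (by simpa [hb] using hy) m
      refine ⟨max n (i + 1), ?_⟩
      beta_reduce
      rw [getElem?_pre x (show i < max n (i + 1) by omega), hb]
      exact hn.trans (mg _ _ (pre_mono x (le_max_left _ _)))

theorem IsComputable.to₂ {T : Cantor →. Cantor} (hT : IsComputable T) :
    IsComputable₂ fun x y => T (Weihrauch.pair x y) := by
  simpa [IsComputable₂] using hT

theorem some_bind (F : Cantor →. Cantor) (x : Cantor) : (Part.some x).bind F = F x :=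
  Part.bind_some x F

theorem SWLE.refl (f : MultiFun) : SWLE f f :=
  ⟨_, _, IsComputable.id, IsComputable.id, fun x hx =>
    ⟨x, Part.mem_some _, hx, fun y hy => ⟨y, Part.mem_some _, hy⟩⟩⟩

theorem WLE.refl (f : MultiFun) : WLE f f :=
  ⟨_, _, IsComputable.id, IsComputable.snd.to₂, fun x hx =>
    ⟨x, Part.mem_some _, hx, fun y hy => ⟨y, by simp, hy⟩⟩⟩

theorem SWLE.trans {f g k : MultiFun} : SWLE f g → SWLE g k → SWLE f k := by
  rintro ⟨H, K, hH, hK, h⟩ ⟨H', K', hH', hK', h'⟩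
  refine ⟨_, _, hH'.comp hH, hK.comp hK', fun x hx => ?_⟩
  obtain ⟨z, hz, hzg, hz'⟩ := h x hx
  obtain ⟨z', hz1, hzk, hz2⟩ := h' z hzg
  refine ⟨z', Part.mem_bind hz hz1, hzk, fun y hy => ?_⟩
  obtain ⟨w, hw, hwg⟩ := hz2 y hy
  obtain ⟨v, hv, hvf⟩ := hz' w hwg
  exact ⟨v, Part.mem_bind hw hv, hvf⟩

theorem WLE.trans {f g k : MultiFun} : WLE f g → WLE g k → WLE f k := by
  rintro ⟨H, K, hH, hK, h⟩ ⟨H', K', hH', hK', h'⟩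
  have A := hK'.comp ((hH.comp IsComputable.fst).pair IsComputable.snd)
  have B := hK.comp (IsComputable.fst.pair A)
  refine ⟨_, _, hH'.comp hH, B.to₂, fun x hx => ?_⟩
  obtain ⟨z, hz, hzg, hz'⟩ := h x hx
  obtain ⟨z', hz1, hzk, hz2⟩ := h' z hzg
  refine ⟨z', Part.mem_bind hz hz1, hzk, fun y hy => ?_⟩
  obtain ⟨w, hw, hwg⟩ := hz2 y hy
  obtain ⟨v, hv, hvf⟩ := hz' w hwg
  refine ⟨v, ?_, hvf⟩
  simp only [fst_pair, snd_pair, some_bind, Part.bind_some, Part.map_some, Part.mem_bind_iff,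
    Part.mem_map_iff]
  exact ⟨pair x w, ⟨w, ⟨pair z y, ⟨z, hz, by simp⟩, by simpa [some_bind] using hw⟩, rfl⟩, by simpa using hv⟩

theorem SWLE.prod {f f' g g' : MultiFun} :
    SWLE f f' → SWLE g g' → SWLE (prod f g) (prod f' g') := by
  rintro ⟨H, K, hH, hK, h⟩ ⟨H', K', hH', hK', h'⟩
  refine ⟨_, _, (hH.comp IsComputable.fst).pair (hH'.comp IsComputable.snd),
    (hK.comp IsComputable.fst).pair (hK'.comp IsComputable.snd), ?_⟩
  rintro x ⟨_, p, hp, q, hq, -⟩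
  obtain ⟨z, hz, ⟨r, hr⟩, hz'⟩ := h _ ⟨p, hp⟩
  obtain ⟨v, hv, ⟨s, hs⟩, hv'⟩ := h' _ ⟨q, hq⟩
  refine ⟨pair z v, ?_, ⟨pair r s, r, by simpa using hr, s, by simpa using hs, rfl⟩, ?_⟩
  · simpa [some_bind] using ⟨z, hz, v, hv, rfl⟩
  · rintro _ ⟨a, ha, b, hb, rfl⟩
    obtain ⟨c, hc, hcf⟩ := hz' a (by simpa using ha)
    obtain ⟨d, hd, hdg⟩ := hv' b (by simpa using hb)
    exact ⟨pair c d, by simpa [some_bind] using ⟨c, hc, d, hd, rfl⟩, c, hcf, d, hdg, rfl⟩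

theorem WLE.prod {f f' g g' : MultiFun} :
    WLE f f' → WLE g g' → WLE (prod f g) (prod f' g') := by
  rintro ⟨H, K, hH, hK, h⟩ ⟨H', K', hH', hK', h'⟩
  have A := hK.comp ((IsComputable.fst.comp IsComputable.fst).pair
    (IsComputable.fst.comp IsComputable.snd))
  have B := hK'.comp ((IsComputable.snd.comp IsComputable.fst).pair
    (IsComputable.snd.comp IsComputable.snd))
  refine ⟨_, _, (hH.comp IsComputable.fst).pair (hH'.comp IsComputable.snd), (A.pair B).to₂, ?_⟩
  rintro x ⟨_, p, hp, q, hq, -⟩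
  obtain ⟨z, hz, ⟨r, hr⟩, hz'⟩ := h _ ⟨p, hp⟩
  obtain ⟨v, hv, ⟨s, hs⟩, hv'⟩ := h' _ ⟨q, hq⟩
  refine ⟨pair z v, ?_, ⟨pair r s, r, by simpa using hr, s, by simpa using hs, rfl⟩, ?_⟩
  · simpa [some_bind] using ⟨z, hz, v, hv, rfl⟩
  · rintro _ ⟨a, ha, b, hb, rfl⟩
    obtain ⟨c, hc, hcf⟩ := hz' a (by simpa using ha)
    obtain ⟨d, hd, hdg⟩ := hv' b (by simpa using hb)
    exact ⟨pair c d, by simpa [some_bind] using ⟨c, hc, d, hd, rfl⟩, c, hcf, d, hdg, rfl⟩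

theorem mem_dom_meet {f g : MultiFun} {x : Cantor} :
    x ∈ dom (meet f g) ↔ fst x ∈ dom f ∧ snd x ∈ dom g := by
  constructor
  · rintro ⟨_, h, h', -⟩
    exact ⟨h, h'⟩
  · rintro ⟨⟨p, hp⟩, h'⟩
    exact ⟨cons false p, ⟨p, hp⟩, h', Or.inl ⟨p, hp, rfl⟩⟩

theorem SWLE.meet {f f' g g' : MultiFun} :
    SWLE f f' → SWLE g g' → SWLE (meet f g) (meet f' g') := by
  rintro ⟨H, K, hH, hK, h⟩ ⟨H', K', hH', hK', h'⟩
  have A := (IsComputable.cons false).comp (hK.comp IsComputable.tail)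
  have B := (IsComputable.cons true).comp (hK'.comp IsComputable.tail)
  refine ⟨_, _, (hH.comp IsComputable.fst).pair (hH'.comp IsComputable.snd), A.branch 0 B, ?_⟩
  intro x hx
  obtain ⟨h1, h2⟩ := mem_dom_meet.1 hx
  obtain ⟨z, hz, hzf, hz'⟩ := h _ h1
  obtain ⟨v, hv, hvg, hv'⟩ := h' _ h2
  refine ⟨pair z v, ?_, mem_dom_meet.2 (by simpa using ⟨hzf, hvg⟩), ?_⟩
  · simpa [some_bind] using ⟨z, hz, v, hv, rfl⟩
  · rintro _ ⟨-, -, ⟨a, ha, rfl⟩ | ⟨b, hb, rfl⟩⟩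
    · obtain ⟨c, hc, hcf⟩ := hz' a (by simpa using ha)
      exact ⟨cons false c, by simpa [some_bind] using ⟨c, hc, rfl⟩, h1, h2, Or.inl ⟨c, hcf, rfl⟩⟩
    · obtain ⟨d, hd, hdg⟩ := hv' b (by simpa using hb)
      exact ⟨cons true d, by simpa [some_bind] using ⟨d, hd, rfl⟩, h1, h2, Or.inr ⟨d, hdg, rfl⟩⟩

theorem WLE.meet {f f' g g' : MultiFun} :
    WLE f f' → WLE g g' → WLE (meet f g) (meet f' g') := by
  rintro ⟨H, K, hH, hK, h⟩ ⟨H', K', hH', hK', h'⟩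
  have T := IsComputable.tail.comp IsComputable.snd
  have A := (IsComputable.cons false).comp
    (hK.comp ((IsComputable.fst.comp IsComputable.fst).pair T))
  have B := (IsComputable.cons true).comp
    (hK'.comp ((IsComputable.snd.comp IsComputable.fst).pair T))
  refine ⟨_, _, (hH.comp IsComputable.fst).pair (hH'.comp IsComputable.snd),
    (A.branch 1 B).to₂, ?_⟩
  intro x hx
  obtain ⟨h1, h2⟩ := mem_dom_meet.1 hx
  obtain ⟨z, hz, hzf, hz'⟩ := h _ h1
  obtain ⟨v, hv, hvg, hv'⟩ := h' _ h2
  refine ⟨pair z v, ?_, mem_dom_meet.2 (by simpa using ⟨hzf, hvg⟩), ?_⟩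
  · simpa [some_bind] using ⟨z, hz, v, hv, rfl⟩
  · have e : ∀ b p, pair x (cons b p) 1 = b := fun b p => rfl
    rintro _ ⟨-, -, ⟨a, ha, rfl⟩ | ⟨b, hb, rfl⟩⟩
    · obtain ⟨c, hc, hcf⟩ := hz' a (by simpa using ha)
      exact ⟨cons false c, by simpa [e, some_bind] using ⟨c, hc, rfl⟩, h1, h2, Or.inl ⟨c, hcf, rfl⟩⟩
    · obtain ⟨d, hd, hdg⟩ := hv' b (by simpa using hb)
      exact ⟨cons true d, by simpa [e, some_bind] using ⟨d, hd, rfl⟩, h1, h2, Or.inr ⟨d, hdg, rfl⟩⟩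

/-! ### The degrees -/

/-- Weihrauch equivalence. -/
def wSetoid : Setoid MultiFun where
  r f g := WLE f g ∧ WLE g f
  iseqv :=
    ⟨fun f => ⟨WLE.refl f, WLE.refl f⟩, fun h => ⟨h.2, h.1⟩,
      fun h h' => ⟨h.1.trans h'.1, h'.2.trans h.2⟩⟩

/-- Strong Weihrauch equivalence. -/
def swSetoid : Setoid MultiFun where
  r f g := SWLE f g ∧ SWLE g f
  iseqv :=
    ⟨fun f => ⟨SWLE.refl f, SWLE.refl f⟩, fun h => ⟨h.2, h.1⟩,
      fun h h' => ⟨h.1.trans h'.1, h'.2.trans h.2⟩⟩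

/-- The Weihrauch degrees. -/
def WDegree : Type := Quotient wSetoid

/-- The strong Weihrauch degrees. -/
def SWDegree : Type := Quotient swSetoid

/-- The operation `⊓` on the Weihrauch degrees. -/
instance : Min WDegree where
  min := Quotient.map₂ meet fun _ _ h _ _ h' => ⟨h.1.meet h'.1, h.2.meet h'.2⟩

/-- The operation `×` on the Weihrauch degrees. -/
instance : Mul WDegree where
  mul := Quotient.map₂ prod fun _ _ h _ _ h' => ⟨h.1.prod h'.1, h.2.prod h'.2⟩

/-- The operation `⊓` on the strong Weihrauch degrees. -/
instance : Min SWDegree where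
  min := Quotient.map₂ meet fun _ _ h _ _ h' => ⟨h.1.meet h'.1, h.2.meet h'.2⟩

/-- The operation `×` on the strong Weihrauch degrees. -/
instance : Mul SWDegree where
  mul := Quotient.map₂ prod fun _ _ h _ _ h' => ⟨h.1.prod h'.1, h.2.prod h'.2⟩

/-! ### Terms and equational theories -/

/-- Terms over the signature `(⊓, ×)` with countably many variables. -/
inductive Term : Type
  | var (n : ℕ) : Term
  | meet (t u : Term) : Term
  | prod (t u : Term) : Term

/-- The value of a term under an assignment of elements of `A` to the variables, in an algebra `A`
with binary operations `⊓` and `×`, the latter being written as a multiplication. -/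
def Term.eval {A : Type} [Min A] [Mul A] (ρ : ℕ → A) : Term → A
  | var n => ρ n
  | meet t u => t.eval ρ ⊓ u.eval ρ
  | prod t u => t.eval ρ * u.eval ρ

/-- The equational theory of the algebra `(A, ⊓, ×)`: the set of the equations `t = u`, given as
pairs `(t, u)` of terms, that are true under every assignment of elements of `A` to the variables. -/
def equationalTheory (A : Type) [Min A] [Mul A] : Set (Term × Term) :=
  {e | ∀ ρ : ℕ → A, e.1.eval ρ = e.2.eval ρ}

end Weihrauch

/-! Validity of an inequality between terms is governed by the same finite combinatorial condition,
`Term.Reduces`, for both reducibilities. An instance of a term is a family of instances at its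
leaves. A solution chooses a side at each meet that has to be solved, and solves exactly the leaves
in the support of that choice. The condition asks for a label-preserving map `φ` from the leaves of
`u` to those of `t` such that whatever choice is made in `u`, the images of the solved leaves
contain the support of some choice in `t`.

The condition gives a strong reduction under every assignment (`Term.Reduces.swle`): instances are
copied along `φ` and solutions are copied back, so the original instance is never consulted.

Conversely, if `t` is Weihrauch reducible to `u` under every assignment, then the condition holds
(`Term.reduces_of_wle`). One assignment is enough, built from a sequence none of whose columns is
computable from the others (`exists_independent_columns`, by Baire category). Each leaf of `t` gets
a column as instance and another as its only solution. The inner reduction reveals `φ`; the outer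
one can output the solution of a leaf of `t` only if that solution was supplied, even though it sees
the original instance. So a valid weak inequality is also a valid strong one; the other direction is
trivial. -/

open Set

namespace Weihrauch

/-! ### Evaluation of terms on multivalued functions -/

/-- The value of a term under an assignment of multivalued functions to the variables. -/
def Term.evalFun (ρ : ℕ → MultiFun) : Term → MultiFun
  | var n => ρ n
  | meet t u => Weihrauch.meet (t.evalFun ρ) (u.evalFun ρ)
  | prod t u => Weihrauch.prod (t.evalFun ρ) (u.evalFun ρ)

theorem Term.eval_mk_wDegree (ρ : ℕ → MultiFun) (t : Term) :
    t.eval (A := WDegree) (fun n => Quotient.mk wSetoid (ρ n)) =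
      Quotient.mk wSetoid (t.evalFun ρ) := by
  induction t with
  | var n => rfl
  | meet t u iht ihu => exact congrArg₂ (· ⊓ ·) iht ihu
  | prod t u iht ihu => exact congrArg₂ (· * ·) iht ihu

theorem Term.eval_mk_swDegree (ρ : ℕ → MultiFun) (t : Term) :
    t.eval (A := SWDegree) (fun n => Quotient.mk swSetoid (ρ n)) =
      Quotient.mk swSetoid (t.evalFun ρ) := by
  induction t with
  | var n => rfl
  | meet t u iht ihu => exact congrArg₂ (· ⊓ ·) iht ihu
  | prod t u iht ihu => exact congrArg₂ (· * ·) iht ihu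

theorem mem_equationalTheory_wDegree {t u : Term} :
    (t, u) ∈ equationalTheory WDegree ↔
      ∀ ρ, WLE (t.evalFun ρ) (u.evalFun ρ) ∧ WLE (u.evalFun ρ) (t.evalFun ρ) := by
  constructor
  · intro h ρ
    have := h fun n => Quotient.mk wSetoid (ρ n)
    simp only [Term.eval_mk_wDegree] at this
    exact Quotient.exact this
  · intro h ρ
    obtain ⟨ρ', rfl⟩ : ∃ ρ' : ℕ → MultiFun, ρ = fun n => Quotient.mk wSetoid (ρ' n) :=
      ⟨fun n => (ρ n).out, funext fun n => (Quotient.out_eq (ρ n)).symm⟩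
    simp only [Term.eval_mk_wDegree]
    exact Quotient.sound (h ρ')

theorem mem_equationalTheory_swDegree {t u : Term} :
    (t, u) ∈ equationalTheory SWDegree ↔
      ∀ ρ, SWLE (t.evalFun ρ) (u.evalFun ρ) ∧ SWLE (u.evalFun ρ) (t.evalFun ρ) := by
  constructor
  · intro h ρ
    have := h fun n => Quotient.mk swSetoid (ρ n)
    simp only [Term.eval_mk_swDegree] at this
    exact Quotient.exact this
  · intro h ρ
    obtain ⟨ρ', rfl⟩ : ∃ ρ' : ℕ → MultiFun, ρ = fun n => Quotient.mk swSetoid (ρ' n) :=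
      ⟨fun n => (ρ n).out, funext fun n => (Quotient.out_eq (ρ n)).symm⟩
    simp only [Term.eval_mk_swDegree]
    exact Quotient.sound (h ρ')

theorem SWLE.wle {f g : MultiFun} : SWLE f g → WLE f g := by
  rintro ⟨H, K, hH, hK, h⟩
  have A := (hK.comp IsComputable.snd).to₂
  refine ⟨H, _, hH, A, fun x hx => ?_⟩
  simpa [some_bind] using h x hx

/-! ### Leaves of terms and resolutions of the meets -/

/-- The occurrences of variables in a term. -/
def Term.Leaf : Term → Type
  | var _ => Unit
  | meet t u => t.Leaf ⊕ u.Leaf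
  | prod t u => t.Leaf ⊕ u.Leaf

/-- The variable at a leaf. -/
def Term.label : (t : Term) → t.Leaf → ℕ
  | var n => fun _ => n
  | meet t u => fun l : t.Leaf ⊕ u.Leaf => l.elim t.label u.label
  | prod t u => fun l : t.Leaf ⊕ u.Leaf => l.elim t.label u.label

/-- The ways to choose one side at each of the meets that have to be solved. -/
def Term.Choice : Term → Type
  | var _ => Unit
  | meet t u => t.Choice ⊕ u.Choice
  | prod t u => t.Choice × u.Choice

/-- The leaves that have to be solved under a choice of sides. -/
def Term.support : (t : Term) → t.Choice → Set t.Leaf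
  | var _ => fun _ => Set.univ
  | meet t u => fun (σ : t.Choice ⊕ u.Choice) (l : t.Leaf ⊕ u.Leaf) =>
      σ.elim (fun σ => l.elim (t.support σ) fun _ => False)
        (fun σ => l.elim (fun _ => False) (u.support σ))
  | prod t u => fun (σ : t.Choice × u.Choice) (l : t.Leaf ⊕ u.Leaf) =>
      l.elim (t.support σ.1) (u.support σ.2)

theorem Term.countable_leaf (t : Term) : Countable t.Leaf := by
  induction t with
  | var n => exact inferInstanceAs (Countable Unit)
  | meet t u iht ihu => exact inferInstanceAs (Countable (t.Leaf ⊕ u.Leaf))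
  | prod t u iht ihu => exact inferInstanceAs (Countable (t.Leaf ⊕ u.Leaf))

/-- The instance of a term that is given by instances at its leaves. -/
def Term.encodeInst : (t : Term) → (t.Leaf → Cantor) → Cantor
  | var _ => fun a => a ()
  | meet t u => fun a => Weihrauch.pair (t.encodeInst fun l => a (Sum.inl l))
      (u.encodeInst fun l => a (Sum.inr l))
  | prod t u => fun a => Weihrauch.pair (t.encodeInst fun l => a (Sum.inl l))
      (u.encodeInst fun l => a (Sum.inr l))

/-- The instances at the leaves that make up an instance of a term. -/
def Term.decodeInst : (t : Term) → Cantor → t.Leaf → Cantor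
  | var _ => fun x _ => x
  | meet t u => fun x (l : t.Leaf ⊕ u.Leaf) =>
      l.elim (t.decodeInst (fst x)) (u.decodeInst (snd x))
  | prod t u => fun x (l : t.Leaf ⊕ u.Leaf) =>
      l.elim (t.decodeInst (fst x)) (u.decodeInst (snd x))

/-- The solution of a term that is given by a choice of sides and solutions at the leaves. -/
def Term.encodeSol : (t : Term) → t.Choice → (t.Leaf → Cantor) → Cantor
  | var _ => fun _ s => s ()
  | meet t u => fun (σ : t.Choice ⊕ u.Choice) s =>
      σ.elim (fun σ => cons false (t.encodeSol σ fun l => s (Sum.inl l)))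
        (fun σ => cons true (u.encodeSol σ fun l => s (Sum.inr l)))
  | prod t u => fun (σ : t.Choice × u.Choice) s =>
      Weihrauch.pair (t.encodeSol σ.1 fun l => s (Sum.inl l))
        (u.encodeSol σ.2 fun l => s (Sum.inr l))

theorem Term.decodeInst_encodeInst (t : Term) (a : t.Leaf → Cantor) :
    t.decodeInst (t.encodeInst a) = a := by
  induction t with
  | var n => rfl
  | meet t u iht ihu =>
    funext l
    rcases l with l | l
    · simp only [decodeInst, encodeInst, fst_pair, Sum.elim_inl, iht]
    · simp only [decodeInst, encodeInst, snd_pair, Sum.elim_inr, ihu]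
  | prod t u iht ihu =>
    funext l
    rcases l with l | l
    · simp only [decodeInst, encodeInst, fst_pair, Sum.elim_inl, iht]
    · simp only [decodeInst, encodeInst, snd_pair, Sum.elim_inr, ihu]

/-- Unsolved leaves leave no trace in a solution. In `Term.reduces_of_wle` this allows a column to
be erased even if it is assigned to a leaf outside the support. -/
theorem Term.encodeSol_congr (t : Term) (σ : t.Choice) {s s' : t.Leaf → Cantor}
    (h : ∀ l ∈ t.support σ, s l = s' l) : t.encodeSol σ s = t.encodeSol σ s' := by
  induction t with
  | var n => exact h () trivial
  | meet t u iht ihu =>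
    rcases σ with σ | σ
    · exact congrArg (cons false) (iht σ fun l hl => h (Sum.inl l) hl)
    · exact congrArg (cons true) (ihu σ fun l hl => h (Sum.inr l) hl)
  | prod t u iht ihu =>
    exact congrArg₂ Weihrauch.pair (iht σ.1 fun l hl => h (Sum.inl l) hl)
      (ihu σ.2 fun l hl => h (Sum.inr l) hl)

theorem mem_dom_prod {f g : MultiFun} {x : Cantor} :
    x ∈ dom (prod f g) ↔ fst x ∈ dom f ∧ snd x ∈ dom g :=
  ⟨fun ⟨_, p, hp, q, hq, _⟩ => ⟨⟨p, hp⟩, q, hq⟩, fun ⟨⟨p, hp⟩, q, hq⟩ => ⟨_, p, hp, q, hq, rfl⟩⟩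

theorem Term.mem_dom_evalFun (ρ : ℕ → MultiFun) (t : Term) (x : Cantor) :
    x ∈ dom (t.evalFun ρ) ↔ ∀ l, t.decodeInst x l ∈ dom (ρ (t.label l)) := by
  induction t generalizing x with
  | var n => exact ⟨fun h _ => h, fun h => h ()⟩
  | meet t u iht ihu =>
    refine mem_dom_meet.trans ?_
    rw [iht, ihu]
    exact ⟨fun h l => Sum.casesOn l h.1 h.2, fun h => ⟨fun l => h (Sum.inl l), fun l => h (Sum.inr l)⟩⟩
  | prod t u iht ihu =>
    refine mem_dom_prod.trans ?_
    rw [iht, ihu]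
    exact ⟨fun h l => Sum.casesOn l h.1 h.2, fun h => ⟨fun l => h (Sum.inl l), fun l => h (Sum.inr l)⟩⟩

/-- The domain condition is a separate conjunct because a meet needs valid instances on both sides,
whereas the support only controls the leaves that are solved. -/
theorem Term.mem_evalFun (ρ : ℕ → MultiFun) (t : Term) (x y : Cantor) :
    y ∈ t.evalFun ρ x ↔ x ∈ dom (t.evalFun ρ) ∧ ∃ σ s,
      (∀ l ∈ t.support σ, s l ∈ ρ (t.label l) (t.decodeInst x l)) ∧ y = t.encodeSol σ s := by
  induction t generalizing x y with
  | var n =>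
    exact ⟨fun h => ⟨⟨y, h⟩, (), fun _ => y, fun _ _ => h, rfl⟩,
      fun ⟨_, _, s, hs, h⟩ => h ▸ hs () trivial⟩
  | meet t u iht ihu =>
    constructor
    · rintro h
      refine ⟨⟨y, h⟩, ?_⟩
      obtain ⟨h1, h2, ⟨p, hp, rfl⟩ | ⟨p, hp, rfl⟩⟩ := h
      · obtain ⟨-, σ, s, hs, rfl⟩ := (iht _ _).1 hp
        -- The constant `false` sequence is a dummy value on the side that is not solved.
        exact ⟨Sum.inl σ, fun l : t.Leaf ⊕ u.Leaf => l.elim s fun _ _ => false,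
          fun l => Sum.casesOn l hs fun _ h => h.elim, rfl⟩
      · obtain ⟨-, σ, s, hs, rfl⟩ := (ihu _ _).1 hp
        exact ⟨Sum.inr σ, fun l : t.Leaf ⊕ u.Leaf => l.elim (fun _ _ => false) s,
          fun l => Sum.casesOn l (fun _ h => h.elim) hs, rfl⟩
    · rintro ⟨hx, σ | σ, s, hs, rfl⟩
      · obtain ⟨h1, h2⟩ := mem_dom_meet.1 hx
        exact ⟨h1, h2, Or.inl ⟨_, (iht _ _).2 ⟨h1, σ, _, fun l hl => hs (Sum.inl l) hl, rfl⟩, rfl⟩⟩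
      · obtain ⟨h1, h2⟩ := mem_dom_meet.1 hx
        exact ⟨h1, h2, Or.inr ⟨_, (ihu _ _).2 ⟨h2, σ, _, fun l hl => hs (Sum.inr l) hl, rfl⟩, rfl⟩⟩
  | prod t u iht ihu =>
    constructor
    · rintro h
      refine ⟨⟨y, h⟩, ?_⟩
      obtain ⟨p, hp, q, hq, rfl⟩ := h
      obtain ⟨-, σ, s, hs, rfl⟩ := (iht _ _).1 hp
      obtain ⟨-, τ, r, hr, rfl⟩ := (ihu _ _).1 hq
      exact ⟨(σ, τ), fun l : t.Leaf ⊕ u.Leaf => l.elim s r, fun l => Sum.casesOn l hs hr, rfl⟩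
    · rintro ⟨hx, σ, s, hs, rfl⟩
      obtain ⟨h1, h2⟩ := mem_dom_prod.1 hx
      exact ⟨_, (iht _ _).2 ⟨h1, σ.1, _, fun l hl => hs (Sum.inl l) hl, rfl⟩,
        _, (ihu _ _).2 ⟨h2, σ.2, _, fun l hl => hs (Sum.inr l) hl, rfl⟩, rfl⟩

/-! ### Computability of the encodings -/

/-- A total function on Cantor space is computable. -/
def IsTotalComputable (G : Cantor → Cantor) : Prop := IsComputable fun x => Part.some (G x)

theorem IsTotalComputable.comp {F G : Cantor → Cantor} (hF : IsTotalComputable F)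
    (hG : IsTotalComputable G) : IsTotalComputable fun x => F (G x) := by
  simpa [IsTotalComputable] using IsComputable.comp hF hG

theorem IsComputable.comp_total {F : Cantor →. Cantor} {G : Cantor → Cantor} (hF : IsComputable F)
    (hG : IsTotalComputable G) : IsComputable fun x => F (G x) := by
  simpa [some_bind] using IsComputable.comp hF hG

theorem IsTotalComputable.pair {F G : Cantor → Cantor} (hF : IsTotalComputable F)
    (hG : IsTotalComputable G) : IsTotalComputable fun x => Weihrauch.pair (F x) (G x) := by
  simpa [IsTotalComputable] using IsComputable.pair hF hG

theorem isTotalComputable_id : IsTotalComputable fun x => x := IsComputable.id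

theorem isTotalComputable_fst : IsTotalComputable fst := IsComputable.fst

theorem isTotalComputable_snd : IsTotalComputable snd := IsComputable.snd

theorem isTotalComputable_cons (b : Bool) : IsTotalComputable (cons b) := IsComputable.cons b

theorem isTotalComputable_tail : IsTotalComputable tail := IsComputable.tail

theorem Term.isTotalComputable_encodeInst (t : Term) {a : Cantor → t.Leaf → Cantor}
    (ha : ∀ l, IsTotalComputable fun x => a x l) :
    IsTotalComputable fun x => t.encodeInst (a x) := by
  induction t with
  | var n => exact ha ()
  | meet t u iht ihu =>
    exact (iht (a := fun x l => a x (Sum.inl l)) fun l => ha (Sum.inl l)).pair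
      (ihu (a := fun x l => a x (Sum.inr l)) fun l => ha (Sum.inr l))
  | prod t u iht ihu =>
    exact (iht (a := fun x l => a x (Sum.inl l)) fun l => ha (Sum.inl l)).pair
      (ihu (a := fun x l => a x (Sum.inr l)) fun l => ha (Sum.inr l))

theorem Term.isTotalComputable_decodeInst (t : Term) (l : t.Leaf) :
    IsTotalComputable fun x => t.decodeInst x l := by
  induction t with
  | var n => exact isTotalComputable_id
  | meet t u iht ihu =>
    rcases l with l | l
    · exact (iht l).comp isTotalComputable_fst
    · exact (ihu l).comp isTotalComputable_snd
  | prod t u iht ihu =>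
    rcases l with l | l
    · exact (iht l).comp isTotalComputable_fst
    · exact (ihu l).comp isTotalComputable_snd

theorem Term.isTotalComputable_encodeSol (t : Term) (σ : t.Choice) {s : Cantor → t.Leaf → Cantor}
    (hs : ∀ l, IsTotalComputable fun x => s x l) :
    IsTotalComputable fun x => t.encodeSol σ (s x) := by
  induction t with
  | var n => exact hs ()
  | meet t u iht ihu =>
    rcases σ with σ | σ
    · exact (isTotalComputable_cons false).comp
        (iht σ (s := fun x l => s x (Sum.inl l)) fun l => hs (Sum.inl l))
    · exact (isTotalComputable_cons true).comp
        (ihu σ (s := fun x l => s x (Sum.inr l)) fun l => hs (Sum.inr l))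
  | prod t u iht ihu =>
    exact (iht σ.1 (s := fun x l => s x (Sum.inl l)) fun l => hs (Sum.inl l)).pair
      (ihu σ.2 (s := fun x l => s x (Sum.inr l)) fun l => hs (Sum.inr l))

/-- With the choice fixed, a solved leaf sits at a known place: the path to it is a composition of
`tail`, `fst` and `snd`. -/
theorem Term.exists_isTotalComputable_leaf (t : Term) (σ : t.Choice) (l : t.Leaf)
    (hl : l ∈ t.support σ) :
    ∃ P, IsTotalComputable P ∧ ∀ s, P (t.encodeSol σ s) = s l := by
  induction t with
  | var n => exact ⟨_, isTotalComputable_id, fun s => rfl⟩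
  | meet t u iht ihu =>
    rcases σ with σ | σ <;> rcases l with l | l
    · obtain ⟨P, hP, h⟩ := iht σ l hl
      exact ⟨_, hP.comp isTotalComputable_tail, fun s => h _⟩
    · exact hl.elim
    · exact hl.elim
    · obtain ⟨P, hP, h⟩ := ihu σ l hl
      exact ⟨_, hP.comp isTotalComputable_tail, fun s => h _⟩
  | prod t u iht ihu =>
    rcases l with l | l
    · obtain ⟨P, hP, h⟩ := iht σ.1 l hl
      exact ⟨_, hP.comp isTotalComputable_fst, fun s => by simp only [encodeSol, fst_pair, h]⟩
    · obtain ⟨P, hP, h⟩ := ihu σ.2 l hl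
      exact ⟨_, hP.comp isTotalComputable_snd, fun s => by simp only [encodeSol, snd_pair, h]⟩

/-- Definition by cases on the choice of sides that is made by a solution is computable. -/
theorem Term.exists_isComputable_cases (t : Term) {Z : Cantor → Cantor} (hZ : IsTotalComputable Z)
    {G : t.Choice → Cantor →. Cantor} (hG : ∀ σ, IsComputable (G σ)) :
    ∃ K, IsComputable K ∧ ∀ y σ s, Z y = t.encodeSol σ s → K y = G σ y := by
  induction t generalizing Z with
  | var n => exact ⟨G (), hG (), fun _ _ _ _ => rfl⟩
  | meet t u iht ihu =>
    obtain ⟨K₀, hK₀, h₀⟩ := iht (isTotalComputable_tail.comp hZ) fun σ => hG (Sum.inl σ)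
    obtain ⟨K₁, hK₁, h₁⟩ := ihu (isTotalComputable_tail.comp hZ) fun σ => hG (Sum.inr σ)
    -- Bit `0` of `pair (Z y) y` is the tag of the solution `Z y`, and `snd` recovers `y`. Keeping
    -- `Z` apart from `y` lets the recursion descend into parts of the solution while `G` still
    -- receives all of `y`.
    refine ⟨_, ((hK₀.comp_total isTotalComputable_snd).branch 0
      (hK₁.comp_total isTotalComputable_snd)).comp_total (hZ.pair isTotalComputable_id), ?_⟩
    have e : ∀ p q, Weihrauch.pair p q 0 = p 0 := fun _ _ => rfl
    rintro y (σ | σ) s hs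
    · simp only [e, snd_pair, hs]
      exact h₀ y σ (fun l => s (Sum.inl l)) (by rw [hs]; rfl)
    · simp only [e, snd_pair, hs]
      exact h₁ y σ (fun l => s (Sum.inr l)) (by rw [hs]; rfl)
  | prod t u iht ihu =>
    -- For each choice on the left, the right factor is decided; the resulting procedures are then
    -- the cases for the left factor.
    have h (σ : t.Choice) := ihu (isTotalComputable_snd.comp hZ) fun τ => hG (σ, τ)
    choose K hK hKG using h
    obtain ⟨L, hL, h⟩ := iht (isTotalComputable_fst.comp hZ) hK
    refine ⟨L, hL, fun y σ s hs => ?_⟩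
    rw [h y σ.1 (fun l => s (Sum.inl l)) (by rw [hs]; simp only [encodeSol, fst_pair])]
    exact hKG σ.1 y σ.2 (fun l => s (Sum.inr l)) (by rw [hs]; simp only [encodeSol, snd_pair])

/-! ### Combinatorial reductions between terms -/

/-- A map from the leaves of `u` to the leaves of `t` that preserves the variables, such that
every way to solve `u` covers some way to solve `t`. -/
def Term.Reduces (t u : Term) : Prop :=
  ∃ φ : u.Leaf → t.Leaf, (∀ m, t.label (φ m) = u.label m) ∧
    ∀ σ, ∃ τ, t.support τ ⊆ φ '' u.support σ

/-- Leaf `m` of `u` receives the instance at `φ m`. A solution of `u` shows its choice `σ`, hence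
the choice `τ σ` for `t`, and every leaf in the support of `τ σ` is `φ m` for a solved `m`, whose
solution is copied. -/
theorem Term.Reduces.swle {t u : Term} (h : t.Reduces u) (ρ : ℕ → MultiFun) :
    SWLE (t.evalFun ρ) (u.evalFun ρ) := by
  classical
  obtain ⟨φ, hφ, h⟩ := h
  choose τ hτ using h
  have hP (σ : u.Choice) (l : t.Leaf) : ∃ P, IsTotalComputable P ∧
      (l ∈ t.support (τ σ) → ∃ m ∈ u.support σ, φ m = l ∧ ∀ s, P (u.encodeSol σ s) = s m) := by
    by_cases hl : l ∈ t.support (τ σ)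
    · obtain ⟨m, hm, rfl⟩ := hτ σ hl
      obtain ⟨P, hP, h⟩ := u.exists_isTotalComputable_leaf σ m hm
      exact ⟨P, hP, fun _ => ⟨m, hm, rfl, h⟩⟩
    -- Off the support any total computable function will do, as the value there is not used.
    · exact ⟨_, isTotalComputable_id, fun h => (hl h).elim⟩
  choose P hPc hP using hP
  obtain ⟨K, hK, hKG⟩ := u.exists_isComputable_cases isTotalComputable_id fun σ =>
    t.isTotalComputable_encodeSol (τ σ) (s := fun y l => P σ l y) fun l => hPc σ l
  refine ⟨_, K, u.isTotalComputable_encodeInst (a := fun x m => t.decodeInst x (φ m))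
    fun m => t.isTotalComputable_decodeInst (φ m), hK, fun x hx => ⟨_, Part.mem_some _, ?_, ?_⟩⟩
  · rw [mem_dom_evalFun] at hx ⊢
    intro m
    rw [decodeInst_encodeInst, ← hφ]
    exact hx _
  · intro y hy
    obtain ⟨-, σ, s, hs, rfl⟩ := (u.mem_evalFun _ _ _).1 hy
    rw [hKG _ σ s rfl]
    refine ⟨_, Part.mem_some _, (t.mem_evalFun _ _ _).2 ⟨hx, τ σ, _, fun l hl => ?_, rfl⟩⟩
    obtain ⟨m, hm, rfl, e⟩ := hP σ l hl
    have := hs m hm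
    rw [decodeInst_encodeInst] at this
    rwa [e, hφ]

/-! ### Independent sequences -/

/-- Position of the `k`-th bit of the `j`-th column of a sequence. -/
def columnPos : ℕ → ℕ → ℕ
  | 0, k => 2 * k
  | j + 1, k => 2 * columnPos j k + 1

/-- The `j`-th column of a sequence. -/
def column (j : ℕ) (c : Cantor) : Cantor := fun k => c (columnPos j k)

theorem columnPos_inj {i j k l : ℕ} (h : columnPos i k = columnPos j l) : i = j ∧ k = l := by
  induction i generalizing j with
  | zero => cases j <;> simp only [columnPos] at h <;> omega
  | succ i ih =>
    cases j with
    | zero => simp only [columnPos] at h; omega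
    | succ j =>
      simp only [columnPos] at h
      have := ih (j := j) (by omega)
      omega

/-- Column `0` is `fst`, and column `j + 1` of a sequence is column `j` of its `snd`. -/
theorem isTotalComputable_column (j : ℕ) : IsTotalComputable (column j) := by
  induction j with
  | zero => exact isTotalComputable_fst
  | succ j ih => exact ih.comp isTotalComputable_snd

open Classical in
/-- The sequence `c` with its `j`-th column erased. -/
noncomputable def erase (j : ℕ) (c : Cantor) : Cantor :=
  fun n => if n ∈ range (columnPos j) then false else c n

theorem column_erase {i j : ℕ} (h : i ≠ j) (c : Cantor) : column i (erase j c) = column i c := by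
  funext k
  have : columnPos i k ∉ range (columnPos j) := fun ⟨l, hl⟩ => h (columnPos_inj hl).1.symm
  simp only [column, erase, if_neg this]

/-- A procedure that reads only `erase j c` cannot notice a flipped bit in column `j`. -/
theorem erase_update (j k : ℕ) (b : Bool) (c : Cantor) :
    erase j (Function.update c (columnPos j k) b) = erase j c := by
  funext n
  unfold erase
  split_ifs with h
  · rfl
  · exact Function.update_of_ne (fun e => h ⟨k, e.symm⟩) _ _

theorem continuous_erase (j : ℕ) : Continuous (erase j) := by
  refine continuous_pi fun n => ?_
  unfold erase
  split_ifs
  · exact continuous_const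
  · exact continuous_apply n

/-- The condition depends on `n` coordinates only, so it is pulled back from a discrete space. -/
theorem isOpen_setOf_pre (n : ℕ) (P : List Bool → Prop) : IsOpen {c | P (pre c n)} := by
  have : Continuous fun (c : Cantor) (i : Fin n) => c i :=
    continuous_pi fun i => continuous_apply _
  have e : {c : Cantor | P (pre c n)} =
      (fun (c : Cantor) (i : Fin n) => c i) ⁻¹' {w | P (List.ofFn w)} := by
    ext c
    have : pre c n = List.ofFn fun i : Fin n => c i := by
      apply List.ext_getElem <;> simp [pre]
    simp [this]
  rw [e]
  exact (isOpen_discrete _).preimage this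

/-- Generically, a column is not computed from the other ones by a given procedure. -/
theorem eventually_residual_not_computes (j : ℕ) {h : List Bool → List Bool}
    (hh : ∀ u v, u <+: v → h u <+: h v) :
    ∀ᶠ c in residual Cantor, ¬ ∀ m, ∃ n, pre (column j c) m <+: h (pre (erase j c) n) := by
  -- `A m`: the procedure outputs bit `m`. `D`: it outputs some wrong bit. It fails on `D` and off
  -- any `A m`; replacing `A m` by its closure makes the set of failures used below open.
  let A (m : ℕ) : Set Cantor := {c | ∃ n, m < (h (pre (erase j c) n)).length}
  let D : Set Cantor := {c | ∃ n k b, (h (pre (erase j c) n))[k]? = some b ∧ column j c k ≠ b}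
  have hD : IsOpen D := by
    simp only [D, ofPred_exists, ofPred_and]
    refine isOpen_iUnion fun n => isOpen_iUnion fun k => isOpen_iUnion fun b => IsOpen.inter ?_ ?_
    · exact (isOpen_setOf_pre n fun u => (h u)[k]? = some b).preimage (continuous_erase j)
    · exact (isOpen_discrete ({b}ᶜ : Set Bool)).preimage
        (continuous_apply (A := fun _ : ℕ => Bool) (columnPos j k))
  have hopen : IsOpen (D ∪ ⋃ m, (closure (A m))ᶜ) :=
    hD.union (isOpen_iUnion fun m => isClosed_closure.isOpen_compl)
  have hdense : Dense (D ∪ ⋃ m, (closure (A m))ᶜ) := by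
    rw [dense_iff_inter_open]
    rintro U hU ⟨c, hc⟩
    obtain ⟨I, v, hv, hIU⟩ := isOpen_pi_iff.1 hU c hc
    -- A basic neighbourhood restricts finitely many positions, so some bit `m` of column `j` is
    -- free. If the procedure outputs bit `m` somewhere in the neighbourhood, flipping the free bit
    -- there makes that output wrong; otherwise the neighbourhood misses `A m`.
    obtain ⟨m, hm⟩ : ∃ m, columnPos j m ∉ I := by
      by_contra! hI
      exact Set.infinite_univ (Set.Finite.of_injOn (f := columnPos j) (s := univ) (t := I)
        (fun k _ => hI k) (fun k _ l _ e => (columnPos_inj e).2) I.finite_toSet)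
    have hpi : IsOpen ((I : Set ℕ).pi v) := isOpen_set_pi I.finite_toSet fun i hi => (hv i hi).1
    by_cases hA : ((I : Set ℕ).pi v ∩ A m).Nonempty
    · obtain ⟨d, hd, n, hn⟩ := hA
      let b := (h (pre (erase j d) n))[m]
      refine ⟨Function.update d (columnPos j m) (!b), hIU fun i hi => ?_, Or.inl ⟨n, m, b, ?_, ?_⟩⟩
      · have hne : i ≠ columnPos j m := by rintro rfl; exact hm hi
        rw [Function.update_of_ne hne]
        exact hd i hi
      · rw [erase_update, List.getElem?_eq_getElem hn]
      · simp [column]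
    · refine ⟨c, hc, Or.inr (mem_iUnion.2 ⟨m, fun hcl => hA ?_⟩)⟩
      exact mem_closure_iff.1 hcl _ hpi fun i hi => (hv i hi).2
  filter_upwards [residual_of_dense_open hopen hdense] with c hc hall
  rcases hc with ⟨n, k, b, hb, hne⟩ | hc
  -- A prefix of length `k + 1` contains bit `k`; by monotonicity the wrong bit persists at the
  -- later stage, where the correct one has to appear.
  · obtain ⟨n', hn'⟩ := hall (k + 1)
    have h1 := hh _ _ (pre_mono (erase j c) (le_max_left n n'))
    have h2 := hn'.trans (hh _ _ (pre_mono (erase j c) (le_max_right n n')))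
    obtain ⟨hk, hkb⟩ := List.getElem?_eq_some_iff.1 hb
    have h3 := List.prefix_iff_getElem?.1 h1 k hk
    rw [(pre_prefix_iff _ _ _).1 h2 k (by omega), hkb] at h3
    exact hne (Option.some.inj h3)
  · obtain ⟨m, hm⟩ := mem_iUnion.1 hc
    obtain ⟨n, hn⟩ := hall (m + 1)
    exact hm (subset_closure ⟨n, by simpa [Nat.succ_le_iff] using hn.length_le⟩)

/-- A program determines the function that it computes, and there are countably many programs. -/
theorem countable_setOf_computable : {h : List Bool → List Bool | Computable h}.Countable := by
  have (h : {h : List Bool → List Bool // Computable h}) :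
      ∃ c : Nat.Partrec.Code, ∀ u, c.eval (Encodable.encode u) =
        Part.some (Encodable.encode (h.1 u)) := by
    obtain ⟨c, hc⟩ := Nat.Partrec.Code.exists_code.1 h.2
    exact ⟨c, fun u => by simp [hc]⟩
  choose c hc using this
  refine (Function.Injective.countable (f := c) fun h h' e => ?_ :
    Countable {h : List Bool → List Bool // Computable h})
  ext1
  funext u
  have := hc h u
  rw [e, hc h' u] at this
  exact (Encodable.encode_injective (Part.some_injective this)).symm

/-- Only countably many pairs of a column and a monotone computable `h` have to be defeated, each on
a residual set, and Cantor space is a Baire space. -/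
theorem exists_independent_columns :
    ∃ c : Cantor, ∀ j F, IsComputable F → column j c ∉ F (erase j c) := by
  have : ∀ᶠ c in residual Cantor, ∀ j, ∀ h ∈ {h : List Bool → List Bool | Computable h ∧ ∀ u v, u <+: v → h u <+: h v},
      ¬ ∀ m, ∃ n, pre (column j c) m <+: h (pre (erase j c) n) :=
    eventually_countable_forall.2 fun j =>
      (eventually_countable_ball (countable_setOf_computable.mono fun _ h => h.1)).2 fun _ h =>
        eventually_residual_not_computes j h.2
  obtain ⟨c, hc⟩ := (dense_of_mem_residual this).nonempty
  exact ⟨c, fun j F ⟨h, hh, hm, hF⟩ hj => hc j h ⟨hh, hm⟩ (hF _ _ hj)⟩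

/-- A column equal to another one could be read off after its own erasure. -/
theorem column_injective_of_independent {c : Cantor}
    (hc : ∀ j F, IsComputable F → column j c ∉ F (erase j c)) :
    Function.Injective fun j => column j c := by
  intro i j h
  by_contra hij
  refine hc j _ (isTotalComputable_column i) ?_
  rw [column_erase hij]
  exact Part.mem_some_iff.2 h.symm

/-! ### Completeness of the combinatorial reductions -/

/-- Any valid instance at a leaf of `u` must be the instance `a c l` of a leaf `l` of `t` with the
same label, which defines `φ` before any choice is made. If the outer reduction solved a leaf
outside the image of the support, it would compute a column from the others. -/
theorem Term.reduces_of_wle {t u : Term} (h : ∀ ρ, WLE (t.evalFun ρ) (u.evalFun ρ)) :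
    t.Reduces u := by
  obtain ⟨c, hc⟩ := exists_independent_columns
  have hinj := column_injective_of_independent hc
  have := t.countable_leaf
  obtain ⟨e, he⟩ := exists_injective_nat t.Leaf
  -- Odd columns serve as instances and even ones as solutions. They are functions of `z` so that
  -- they can also be evaluated at an erased version of `c`.
  let a (z : Cantor) (l : t.Leaf) : Cantor := column (2 * e l + 1) z
  let b (z : Cantor) (l : t.Leaf) : Cantor := column (2 * e l) z
  have ha : Function.Injective (a c) := fun l l' h => he (by have := hinj h; omega)
  let ρ (i : ℕ) : MultiFun := fun x => {y | ∃ l, t.label l = i ∧ x = a c l ∧ y = b c l}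
  obtain ⟨H, K, -, hK, hHK⟩ := h ρ
  obtain ⟨z, -, hz, hKz⟩ := hHK (t.encodeInst (a c)) ((t.mem_dom_evalFun _ _).2 fun l => by
    rw [decodeInst_encodeInst]
    exact ⟨b c l, l, rfl, rfl, rfl⟩)
  have hz' := (u.mem_dom_evalFun _ _).1 hz
  choose y φ hφ hzφ hy using hz'
  refine ⟨φ, hφ, fun σ => ?_⟩
  obtain ⟨w, hw, hwt⟩ := hKz (u.encodeSol σ fun m => b c (φ m))
    ((u.mem_evalFun _ _ _).2 ⟨hz, σ, _, fun m _ => ⟨φ m, hφ m, hzφ m, rfl⟩, rfl⟩)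
  obtain ⟨-, τ, s, hs, rfl⟩ := (t.mem_evalFun _ _ _).1 hwt
  refine ⟨τ, fun l hl => ?_⟩
  by_contra hlφ
  -- Distinct leaves have distinct instances, so `ρ` is single-valued at `a c l`.
  have hsl : s l = b c l := by
    obtain ⟨l', -, h1, h2⟩ := hs l hl
    rw [decodeInst_encodeInst] at h1
    rw [h2, ha h1]
  obtain ⟨P, hP, hPl⟩ := t.exists_isTotalComputable_leaf τ l hl
  -- The procedure builds from `z` the instance of `t` and the solution of `u`, applies the outer
  -- reduction `K` and extracts leaf `l`. At `erase (2 * e l) c` its inputs are the same as at `c`: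
  -- instances are odd columns, and the solutions on the support of `σ` belong to leaves other than
  -- `l`.
  have hF := IsComputable.comp hP (hK.comp_total
    ((t.isTotalComputable_encodeInst (a := a) fun l => isTotalComputable_column _).pair
      (u.isTotalComputable_encodeSol σ (s := fun z m => b z (φ m))
        fun m => isTotalComputable_column _)))
  refine hc (2 * e l) _ hF ?_
  have h1 : a (erase (2 * e l) c) = a c := funext fun l' => column_erase (by omega) c
  have h2 : u.encodeSol σ (fun m => b (erase (2 * e l) c) (φ m)) =
      u.encodeSol σ fun m => b c (φ m) := by
    refine u.encodeSol_congr σ fun m hm => column_erase (fun h => hlφ ⟨m, hm, he ?_⟩) c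
    omega
  simp only [h1, h2, fst_pair, snd_pair]
  refine Part.mem_bind hw ?_
  rw [hPl, hsl]
  exact Part.mem_some _

end Weihrauch

/-- The Weihrauch degrees and the strong Weihrauch degrees, both with the operations `⊓` and `×`,
have the same equational theory. -/
theorem corollary15 :
    Weihrauch.equationalTheory Weihrauch.WDegree =
      Weihrauch.equationalTheory Weihrauch.SWDegree := by
  ext ⟨t, u⟩
  rw [Weihrauch.mem_equationalTheory_wDegree, Weihrauch.mem_equationalTheory_swDegree]
  exact ⟨fun h ρ => ⟨(Weihrauch.Term.reduces_of_wle fun ρ => (h ρ).1).swle ρ,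
      (Weihrauch.Term.reduces_of_wle fun ρ => (h ρ).2).swle ρ⟩,
    fun h ρ => ⟨(h ρ).1.wle, (h ρ).2.wle⟩⟩
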